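/- Let $R=\mathbb{Z}[u_1^{\pm1},u_2^{\pm1},u_3^{\pm1}]$, let $B=\langle \sigma_1,\sigma_2 \mid \sigma_1\sigma_2\sigma_1=\sigma_2\sigma_1\sigma_2\rangle$ be the braid group of the complex reflection group $G_4$, and let $H$ be the generic Hecke algebra of $G_4$, that is, the quotient of the group algebra $R[B]$ by the two-sided ideal generated by $(\sigma_i-u_1)(\sigma_i-u_2)(\sigma_i-u_3)$ for $i=1,2$. Denote the images of $\sigma_1,\sigma_2$ in $H$ by the same letters, let $H'$ be the $R$-subalgebra of $H$ generated by $\sigma_1$, and regard $H$ as a left $H'$-module by multiplication. Put $z=(\sigma_1\sigma_2)^3$ and $$x_1=1,\quad x_2=\sigma_2,\quad x_3=\sigma_2\sigma_1\sigma_2,\quad x_4=\sigma_2\sigma_1\sigma_2\sigma_1,\quad x_5=zx_1,\quad x_6=zx_2,\quad x_7=zx_3,\quad x_8=zx_4 .$$ Then: (i) $H$ is a free $H'$-module with basis $(x_i)_{1\le i\le 8}$. (ii) $H$ is a free $R$-module with basis the $24$ elements $\sigma_1^m x_i$, where $0\le m\le 2$ and $1\le i\le 8$. -/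

import Mathlib

/-- The Laurent polynomial ring `R = ℤ[u₁^{±1}, u₂^{±1}, u₃^{±1}]`, as the group ring over `ℤ` of the
free abelian group of exponents `ℤ³`. -/
abbrev G4LaurentRing : Type := AddMonoidAlgebra ℤ (Fin 3 →₀ ℤ)

namespace G4

/-- The indeterminates `u₁, u₂, u₃` (indexed by `0, 1, 2`). -/
noncomputable def u (j : Fin 3) : G4LaurentRing :=
  AddMonoidAlgebra.single (Finsupp.single j 1) 1

/-- The single defining relator `s₁s₂s₁(s₂s₁s₂)⁻¹` of the braid group of `G₄`;
the generators `s₁, s₂` are indexed by `0, 1`. -/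
def braidRels : Set (FreeGroup (Fin 2)) :=
  {FreeGroup.of 0 * FreeGroup.of 1 * FreeGroup.of 0 *
    (FreeGroup.of 1 * FreeGroup.of 0 * FreeGroup.of 1)⁻¹}

/-- The complex braid group `B = ⟨s₁, s₂ ∣ s₁s₂s₁ = s₂s₁s₂⟩` of `G₄`. -/
abbrev BraidGroup : Type := PresentedGroup braidRels

/-- The generators of the braid group, inside the group algebra `R[B]`. -/
noncomputable def braidGen (i : Fin 2) : MonoidAlgebra G4LaurentRing BraidGroup :=
  MonoidAlgebra.of G4LaurentRing BraidGroup (PresentedGroup.of i)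

/-- The Hecke relations `(s - u₁)(s - u₂)(s - u₃) = 0` for `s = s₁, s₂`. -/
inductive HeckeRel : MonoidAlgebra G4LaurentRing BraidGroup →
    MonoidAlgebra G4LaurentRing BraidGroup → Prop
  | cubic (i : Fin 2) : HeckeRel
      ((braidGen i - algebraMap G4LaurentRing _ (u 0)) *
        (braidGen i - algebraMap G4LaurentRing _ (u 1)) *
        (braidGen i - algebraMap G4LaurentRing _ (u 2))) 0

/-- The generic Hecke algebra `H` of `G₄`: the quotient of the group algebra `R[B]` by the two-sided
ideal generated by the elements `(s - u₁)(s - u₂)(s - u₃)`. -/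
abbrev HeckeAlgebra : Type := RingQuot HeckeRel

/-- The standard generators `σ₁ = σ 0` and `σ₂ = σ 1` of the Hecke algebra. -/
noncomputable def σ (i : Fin 2) : HeckeAlgebra :=
  RingQuot.mkAlgHom G4LaurentRing HeckeRel (braidGen i)

/-- The subalgebra `H'` of `H` generated by `σ₁`. -/
noncomputable abbrev parabolicSubalgebra : Subalgebra G4LaurentRing HeckeAlgebra :=
  Algebra.adjoin G4LaurentRing {σ 0}

/-- The element `z = (σ₁σ₂)³`. -/
noncomputable def z : HeckeAlgebra := (σ 0 * σ 1) ^ 3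

/-- The elements `x₁, …, x₈` (indexed by `0, …, 7`). -/
noncomputable def x : Fin 8 → HeckeAlgebra :=
  ![1, σ 1, σ 1 * σ 0 * σ 1, σ 1 * σ 0 * σ 1 * σ 0,
    z * 1, z * σ 1, z * (σ 1 * σ 0 * σ 1), z * (σ 1 * σ 0 * σ 1 * σ 0)]

end G4

/-! Write a = σ₁, b = σ₂. Spanning: since x₃ = a·ba and x₄ = a·ba², the span of the words is V + zV
with V = H' + H'bH'. It contains 1, so it is all of H once it is stable under right multiplication
by a, b and their inverses (`wordSpan_eq_top`). For a this follows from the cubic relation. For b it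
rests on z being central and on ba²b = a⁻¹za⁻¹, ba³b = a⁻¹(zb)a⁻¹: the cubic then yields b², and the
one remaining obstacle is z² = a³ba³ba³b (`full_twist_sq_mem`).

Independence: H maps to matrix algebras of sizes 1, 1, 1, 2, 2, 2, 3, with 24 entries in all. The
entries of the 24 words form a square matrix over the domain R, whose determinant is nonzero because
it stays invertible over 𝔽₇ at parameters 1, 2, 4 (`linearIndependent_words`).

Freeness over H' follows from the R-statement because 1, a, a² span H' (`exists_coeff_adjoin`). -/

namespace G4

/-! ### Matrix models of the irreducible representations -/

section Representations

variable {A : Type*} [CommRing A]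

/-- The product of the seven matrix algebras in which the irreducible representations of the Hecke
algebra take their values. -/
abbrev MatrixProduct (A : Type*) : Type _ :=
  A × A × A × Matrix (Fin 2) (Fin 2) A × Matrix (Fin 2) (Fin 2) A × Matrix (Fin 2) (Fin 2) A ×
    Matrix (Fin 3) (Fin 3) A

/-- The image of `σ₁` under the sum of the irreducible representations. -/
def repFst (p q r : A) : MatrixProduct A :=
  (p, q, r, !![p, 1; 0, q], !![p, 1; 0, r], !![q, 1; 0, r],
    !![r, 0, 0; p * r + q ^ 2, q, 0; q, 1, p])

/-- The image of `σ₂` under the sum of the irreducible representations. -/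
def repSnd (p q r : A) : MatrixProduct A :=
  (p, q, r, !![q, 0; -(p * q), p], !![r, 0; -(p * r), p], !![r, 0; -(q * r), q],
    !![p, -1, q; 0, q, -(p * r) - q ^ 2; 0, 0, r])

theorem braid_dim_two (p q : A) :
    !![p, 1; 0, q] * !![q, 0; -(p * q), p] * !![p, 1; 0, q] =
      !![q, 0; -(p * q), p] * !![p, 1; 0, q] * !![q, 0; -(p * q), p] := by
  ext i j
  fin_cases i <;> fin_cases j <;> simp [Matrix.mul_apply, Fin.sum_univ_two] <;> ring

theorem braid_dim_three (p q r : A) :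
    !![r, 0, 0; p * r + q ^ 2, q, 0; q, 1, p] * !![p, -1, q; 0, q, -(p * r) - q ^ 2; 0, 0, r] *
        !![r, 0, 0; p * r + q ^ 2, q, 0; q, 1, p] =
      !![p, -1, q; 0, q, -(p * r) - q ^ 2; 0, 0, r] * !![r, 0, 0; p * r + q ^ 2, q, 0; q, 1, p] *
        !![p, -1, q; 0, q, -(p * r) - q ^ 2; 0, 0, r] := by
  ext i j
  fin_cases i <;> fin_cases j <;> simp [Matrix.mul_apply, Fin.sum_univ_three] <;> ring

theorem repFst_braid (p q r : A) :
    repFst p q r * repSnd p q r * repFst p q r = repSnd p q r * repFst p q r * repSnd p q r := by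
  simp only [repFst, repSnd, Prod.mk_mul_mk, braid_dim_two, braid_dim_three]

theorem cubic_repFst (p q r : A) :
    (repFst p q r - algebraMap A _ p) * (repFst p q r - algebraMap A _ q) *
      (repFst p q r - algebraMap A _ r) = 0 := by
  simp only [repFst, Prod.algebraMap_apply, Prod.mk_sub_mk, Prod.mk_mul_mk, Prod.mk_eq_zero,
    Algebra.algebraMap_self, RingHom.id_apply, sub_self, mul_zero, zero_mul, true_and]
  refine ⟨?_, ?_, ?_, ?_⟩ <;> ext i j <;> fin_cases i <;> fin_cases j <;>
    simp [Matrix.mul_apply, Fin.sum_univ_succ, Matrix.algebraMap_matrix_apply]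

theorem cubic_repSnd (p q r : A) :
    (repSnd p q r - algebraMap A _ p) * (repSnd p q r - algebraMap A _ q) *
      (repSnd p q r - algebraMap A _ r) = 0 := by
  simp only [repSnd, Prod.algebraMap_apply, Prod.mk_sub_mk, Prod.mk_mul_mk, Prod.mk_eq_zero,
    Algebra.algebraMap_self, RingHom.id_apply, sub_self, mul_zero, zero_mul, true_and]
  refine ⟨?_, ?_, ?_, ?_⟩ <;> ext i j <;> fin_cases i <;> fin_cases j <;>
    simp [Matrix.mul_apply, Fin.sum_univ_succ, Matrix.algebraMap_matrix_apply]

/-- The `24` matrix coordinates on the product of the matrix algebras. -/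
def coordinates : MatrixProduct A →ₗ[A] Fin 24 → A where
  toFun n := ![n.1, n.2.1, n.2.2.1,
    n.2.2.2.1 0 0, n.2.2.2.1 0 1, n.2.2.2.1 1 0, n.2.2.2.1 1 1,
    n.2.2.2.2.1 0 0, n.2.2.2.2.1 0 1, n.2.2.2.2.1 1 0, n.2.2.2.2.1 1 1,
    n.2.2.2.2.2.1 0 0, n.2.2.2.2.2.1 0 1, n.2.2.2.2.2.1 1 0, n.2.2.2.2.2.1 1 1,
    n.2.2.2.2.2.2 0 0, n.2.2.2.2.2.2 0 1, n.2.2.2.2.2.2 0 2,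
    n.2.2.2.2.2.2 1 0, n.2.2.2.2.2.2 1 1, n.2.2.2.2.2.2 1 2,
    n.2.2.2.2.2.2 2 0, n.2.2.2.2.2.2 2 1, n.2.2.2.2.2.2 2 2]
  map_add' m n := by ext j; fin_cases j <;> rfl
  map_smul' a n := by ext j; fin_cases j <;> rfl

/-- The ring homomorphism of matrix products induced by one of the coefficient rings. -/
def mapMatrixProduct {A' : Type*} [CommRing A'] (f : A →+* A') :
    MatrixProduct A →+* MatrixProduct A' :=
  f.prodMap <| f.prodMap <| f.prodMap <| f.mapMatrix.prodMap <| f.mapMatrix.prodMap <|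
    f.mapMatrix.prodMap f.mapMatrix

theorem coordinates_mapMatrixProduct {A' : Type*} [CommRing A'] (f : A →+* A')
    (n : MatrixProduct A) (j : Fin 24) :
    coordinates (mapMatrixProduct f n) j = f (coordinates n j) := by
  fin_cases j <;> rfl

theorem mapMatrixProduct_repFst {A' : Type*} [CommRing A'] (f : A →+* A') (p q r : A) :
    mapMatrixProduct f (repFst p q r) = repFst (f p) (f q) (f r) := by
  simp only [mapMatrixProduct, repFst, RingHom.coe_prodMap, Prod.map_apply, RingHom.mapMatrix_apply,
    Prod.mk.injEq, true_and]
  refine ⟨?_, ?_, ?_, ?_⟩ <;> ext i j <;> fin_cases i <;> fin_cases j <;> simp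

theorem mapMatrixProduct_repSnd {A' : Type*} [CommRing A'] (f : A →+* A') (p q r : A) :
    mapMatrixProduct f (repSnd p q r) = repSnd (f p) (f q) (f r) := by
  simp only [mapMatrixProduct, repSnd, RingHom.coe_prodMap, Prod.map_apply, RingHom.mapMatrix_apply,
    Prod.mk.injEq, true_and]
  refine ⟨?_, ?_, ?_, ?_⟩ <;> ext i j <;> fin_cases i <;> fin_cases j <;> simp

end Representations

/-! ### The eight words in an arbitrary monoid -/

section Words

variable {E : Type*} [Monoid E]

/-- The words `x₁, …, x₈` in two elements of a ring. -/
def xWord (a b : E) : Fin 8 → E :=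
  ![1, b, b * a * b, b * a * b * a, (a * b) ^ 3 * 1, (a * b) ^ 3 * b, (a * b) ^ 3 * (b * a * b),
    (a * b) ^ 3 * (b * a * b * a)]

theorem map_xWord {E' F : Type*} [Monoid E'] [FunLike F E E'] [MonoidHomClass F E E'] (f : F)
    (a b : E) (i : Fin 8) :
    f (xWord a b i) = xWord (f a) (f b) i := by
  fin_cases i <;> simp [xWord]

end Words

/-! ### Explicit computation over 𝔽₇ -/

section Specialisation

/-- The coordinates of the words `σ₁ᵐ xᵢ` over `𝔽₇` at the parameters `1, 2, 4`. -/
def coordMatrix : Matrix (Fin 24) (Fin 24) (ZMod 7) :=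
  !![1, 1, 1, 1, 0, 0, 1, 1, 0, 0, 1, 1, 0, 0, 1, 1, 0, 0, 0, 1, 0, 0, 0, 1;
    1, 2, 4, 1, 1, 0, 2, 1, 1, 0, 4, 2, 1, 0, 4, 4, 0, 0, 1, 2, 0, 2, 1, 1;
    1, 4, 2, 1, 3, 0, 4, 1, 5, 0, 2, 4, 6, 0, 2, 2, 0, 0, 6, 4, 0, 4, 3, 1;
    1, 2, 4, 2, 0, 5, 1, 4, 0, 3, 1, 4, 0, 6, 2, 1, 6, 2, 0, 2, 6, 0, 0, 4;
    1, 4, 2, 0, 1, 3, 2, 0, 1, 5, 4, 0, 2, 3, 1, 4, 3, 1, 1, 3, 0, 2, 0, 0;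
    1, 1, 1, 3, 3, 6, 4, 5, 5, 6, 2, 3, 5, 5, 4, 2, 5, 4, 6, 2, 1, 4, 2, 2;
    1, 1, 1, 0, 2, 3, 0, 0, 4, 5, 0, 0, 1, 6, 0, 0, 0, 1, 0, 6, 0, 1, 0, 0;
    1, 2, 4, 3, 2, 6, 0, 5, 4, 6, 0, 6, 2, 3, 0, 0, 0, 4, 0, 5, 1, 1, 6, 2;
    1, 4, 2, 2, 2, 5, 0, 4, 4, 3, 0, 1, 4, 5, 0, 0, 0, 2, 0, 3, 6, 1, 4, 4;
    1, 2, 4, 0, 4, 3, 3, 0, 2, 5, 5, 0, 4, 5, 6, 2, 1, 1, 6, 5, 0, 4, 0, 0;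
    1, 4, 2, 3, 0, 6, 6, 5, 0, 6, 6, 5, 0, 6, 3, 1, 4, 4, 0, 4, 1, 0, 0, 2;
    1, 1, 1, 2, 6, 5, 5, 4, 6, 3, 3, 2, 3, 3, 5, 4, 2, 2, 1, 5, 6, 2, 5, 4;
    1, 1, 1, 6, 0, 0, 6, 6, 0, 0, 6, 6, 0, 0, 6, 1, 0, 0, 0, 1, 0, 0, 0, 1;
    1, 2, 4, 6, 6, 0, 5, 6, 6, 0, 3, 5, 6, 0, 3, 4, 0, 0, 1, 2, 0, 2, 1, 1;
    1, 4, 2, 6, 4, 0, 3, 6, 2, 0, 5, 3, 1, 0, 5, 2, 0, 0, 6, 4, 0, 4, 3, 1;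
    1, 2, 4, 5, 0, 2, 6, 3, 0, 4, 6, 3, 0, 1, 5, 1, 6, 2, 0, 2, 6, 0, 0, 4;
    1, 4, 2, 0, 6, 4, 5, 0, 6, 2, 3, 0, 5, 4, 6, 4, 3, 1, 1, 3, 0, 2, 0, 0;
    1, 1, 1, 4, 4, 1, 3, 2, 2, 1, 5, 4, 2, 2, 3, 2, 5, 4, 6, 2, 1, 4, 2, 2;
    1, 1, 1, 0, 5, 4, 0, 0, 3, 2, 0, 0, 6, 1, 0, 0, 0, 1, 0, 6, 0, 1, 0, 0;
    1, 2, 4, 4, 5, 1, 0, 2, 3, 1, 0, 1, 5, 4, 0, 0, 0, 4, 0, 5, 1, 1, 6, 2;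
    1, 4, 2, 5, 5, 2, 0, 3, 3, 4, 0, 6, 3, 2, 0, 0, 0, 2, 0, 3, 6, 1, 4, 4;
    1, 2, 4, 0, 3, 4, 4, 0, 5, 2, 2, 0, 3, 2, 1, 2, 1, 1, 6, 5, 0, 4, 0, 0;
    1, 4, 2, 4, 0, 1, 1, 2, 0, 1, 1, 2, 0, 1, 4, 1, 4, 4, 0, 4, 1, 0, 0, 2;
    1, 1, 1, 5, 1, 2, 2, 3, 1, 4, 4, 5, 4, 4, 2, 4, 2, 2, 1, 5, 6, 2, 5, 4]

/-- The inverse of `coordMatrix`. -/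
def coordMatrixInv : Matrix (Fin 24) (Fin 24) (ZMod 7) :=
  !![5, 5, 5, 5, 5, 5, 5, 5, 5, 5, 5, 5, 5, 5, 5, 5, 5, 5, 5, 5, 5, 5, 5, 5;
    5, 6, 3, 6, 3, 5, 5, 6, 3, 6, 3, 5, 5, 6, 3, 6, 3, 5, 5, 6, 3, 6, 3, 5;
    5, 3, 6, 3, 6, 5, 5, 3, 6, 3, 6, 5, 5, 3, 6, 3, 6, 5, 5, 3, 6, 3, 6, 5;
    3, 3, 3, 5, 5, 5, 0, 0, 0, 1, 1, 1, 4, 4, 4, 2, 2, 2, 0, 0, 0, 6, 6, 6;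
    0, 0, 0, 3, 3, 3, 5, 5, 5, 6, 6, 6, 0, 0, 0, 4, 4, 4, 2, 2, 2, 1, 1, 1;
    0, 2, 3, 0, 1, 5, 1, 4, 2, 1, 0, 3, 0, 5, 4, 0, 6, 2, 6, 3, 5, 6, 0, 4;
    3, 5, 6, 3, 0, 2, 0, 1, 5, 0, 4, 6, 4, 2, 1, 4, 0, 5, 0, 6, 2, 0, 3, 1;
    3, 3, 3, 6, 6, 6, 0, 0, 0, 2, 2, 2, 4, 4, 4, 1, 1, 1, 0, 0, 0, 5, 5, 5;
    0, 0, 0, 3, 3, 3, 6, 6, 6, 5, 5, 5, 0, 0, 0, 4, 4, 4, 1, 1, 1, 2, 2, 2;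
    0, 1, 3, 0, 2, 6, 2, 4, 1, 2, 0, 3, 0, 6, 4, 0, 5, 1, 5, 3, 6, 5, 0, 4;
    3, 6, 5, 3, 0, 1, 0, 2, 6, 0, 4, 5, 4, 1, 2, 4, 0, 6, 0, 5, 1, 0, 3, 2;
    3, 5, 6, 6, 3, 5, 0, 0, 0, 4, 2, 1, 4, 2, 1, 1, 4, 2, 0, 0, 0, 3, 5, 6;
    0, 0, 0, 3, 5, 6, 3, 5, 6, 6, 3, 5, 0, 0, 0, 4, 2, 1, 4, 2, 1, 1, 4, 2;
    0, 4, 3, 0, 1, 6, 4, 1, 2, 2, 0, 5, 0, 3, 4, 0, 6, 1, 3, 6, 5, 5, 0, 2;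
    3, 6, 5, 5, 0, 2, 0, 4, 3, 0, 1, 6, 4, 1, 2, 2, 0, 5, 0, 3, 4, 0, 6, 1;
    1, 2, 4, 1, 0, 2, 0, 4, 2, 0, 1, 4, 1, 2, 4, 1, 0, 2, 0, 4, 2, 0, 1, 4;
    0, 6, 1, 0, 0, 6, 0, 1, 6, 0, 0, 1, 0, 6, 1, 0, 0, 6, 0, 1, 6, 0, 0, 1;
    0, 4, 2, 0, 1, 4, 1, 2, 4, 1, 0, 2, 0, 4, 2, 0, 1, 4, 1, 2, 4, 1, 0, 2;
    0, 0, 0, 4, 0, 5, 0, 3, 1, 0, 6, 2, 0, 0, 0, 4, 0, 5, 0, 3, 1, 0, 6, 2;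
    1, 4, 2, 4, 5, 2, 6, 3, 5, 3, 2, 5, 1, 4, 2, 4, 5, 2, 6, 3, 5, 3, 2, 5;
    0, 3, 1, 0, 6, 2, 0, 0, 0, 4, 0, 5, 0, 3, 1, 0, 6, 2, 0, 0, 0, 4, 0, 5;
    0, 0, 0, 4, 4, 4, 1, 1, 1, 2, 2, 2, 0, 0, 0, 4, 4, 4, 1, 1, 1, 2, 2, 2;
    0, 0, 0, 1, 1, 1, 0, 0, 0, 6, 6, 6, 0, 0, 0, 1, 1, 1, 0, 0, 0, 6, 6, 6;
    1, 1, 1, 2, 2, 2, 0, 0, 0, 4, 4, 4, 1, 1, 1, 2, 2, 2, 0, 0, 0, 4, 4, 4]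

theorem coordMatrix_mul_inv : coordMatrix * coordMatrixInv = 1 := by
  decide +kernel

set_option synthInstance.maxSize 2000 in
instance : DecidableEq (MatrixProduct (ZMod 7)) := inferInstance

/-- Partial products are evaluated once and reused, which keeps each kernel computation small. Here
z acts by ±1. -/
theorem xWord_specialised :
    xWord (repFst 1 2 4 : MatrixProduct (ZMod 7)) (repSnd 1 2 4) =
      ![1, (1, 2, 4, !![2, 0; 5, 1], !![4, 0; 3, 1], !![4, 0; 6, 2], !![1, 6, 2; 0, 2, 6; 0, 0, 4]),
        (1, 1, 1, !![0, 2; 3, 0], !![0, 4; 5, 0], !![0, 1; 6, 0], !![0, 0, 1; 0, 6, 0; 1, 0, 0]),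
        (1, 2, 4, !![0, 4; 3, 3], !![0, 2; 5, 5], !![0, 4; 5, 6], !![2, 1, 1; 6, 5, 0; 4, 0, 0]),
        (1, 1, 1, !![6, 0; 0, 6], !![6, 0; 0, 6], !![6, 0; 0, 6], !![1, 0, 0; 0, 1, 0; 0, 0, 1]),
        (1, 2, 4, !![5, 0; 2, 6], !![3, 0; 4, 6], !![3, 0; 1, 5], !![1, 6, 2; 0, 2, 6; 0, 0, 4]),
        (1, 1, 1, !![0, 5; 4, 0], !![0, 3; 2, 0], !![0, 6; 1, 0], !![0, 0, 1; 0, 6, 0; 1, 0, 0]),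
        (1, 2, 4, !![0, 3; 4, 4], !![0, 5; 2, 2], !![0, 3; 2, 1], !![2, 1, 1; 6, 5, 0; 4, 0, 0])] := by
  have hab : (repFst 1 2 4 * repSnd 1 2 4 : MatrixProduct (ZMod 7)) =
      (1, 4, 2, !![0, 1; 3, 2], !![0, 1; 5, 4], !![0, 2; 3, 1], !![4, 3, 1; 1, 3, 0; 2, 0, 0]) := by
    decide +kernel
  have hz : (repFst 1 2 4 * repSnd 1 2 4 : MatrixProduct (ZMod 7)) ^ 3 =
      (1, 1, 1, !![6, 0; 0, 6], !![6, 0; 0, 6], !![6, 0; 0, 6], !![1, 0, 0; 0, 1, 0; 0, 0, 1]) := by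
    rw [hab]
    decide +kernel
  have hbab : (repSnd 1 2 4 * repFst 1 2 4 * repSnd 1 2 4 : MatrixProduct (ZMod 7)) =
      (1, 1, 1, !![0, 2; 3, 0], !![0, 4; 5, 0], !![0, 1; 6, 0], !![0, 0, 1; 0, 6, 0; 1, 0, 0]) := by
    rw [mul_assoc, hab]
    decide +kernel
  have hbaba : (repSnd 1 2 4 * repFst 1 2 4 * repSnd 1 2 4 * repFst 1 2 4 :
      MatrixProduct (ZMod 7)) =
      (1, 2, 4, !![0, 4; 3, 3], !![0, 2; 5, 5], !![0, 4; 5, 6], !![2, 1, 1; 6, 5, 0; 4, 0, 0]) := by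
    rw [hbab]
    decide +kernel
  unfold xWord
  rw [hz, hbaba, hbab]
  decide +kernel

theorem coordinates_specialised (i : Fin 8) (m : Fin 3) :
    coordinates ((repFst 1 2 4 : MatrixProduct (ZMod 7)) ^ (m : ℕ) *
      xWord (repFst 1 2 4) (repSnd 1 2 4) i) = coordMatrix (finProdFinEquiv (i, m)) := by
  rw [xWord_specialised]
  revert i m
  decide +kernel

end Specialisation

/-! ### Stability of the span under right multiplication -/

section Spanning

variable {R E : Type*} [CommRing R] [Ring E] [Algebra R E]

/-- Two invertible elements `a`, `b` of an algebra satisfy the braid relation and a common cubic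
equation `t³ - e₁ t² + e₂ t - e₃ = 0` with `e₃` invertible. -/
structure CubicBraidPair (e₁ e₂ e₃ e₃' : R) (a a' b b' : E) : Prop where
  mul_inv_coeff : e₃' * e₃ = 1
  inv_mul_fst : a' * a = 1
  mul_inv_fst : a * a' = 1
  mul_inv_snd : b * b' = 1
  braid : b * (a * b) = a * (b * a)
  cubic_fst : a * (a * a) + e₂ • a = e₁ • (a * a) + e₃ • 1
  cubic_snd : b * (b * b) + e₂ • b = e₁ • (b * b) + e₃ • 1

/-- The `R`-linear span of the elements `aᵐ xᵢ`. -/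
def wordSpan (R : Type*) {E : Type*} [CommRing R] [Ring E] [Algebra R E] (a b : E) :
    Submodule R E :=
  Submodule.span R (Set.range fun p : Fin 8 × Fin 3 => a ^ (p.2 : ℕ) * xWord a b p.1)

theorem xWord_mem_wordSpan (a b : E) (i : Fin 8) : xWord a b i ∈ wordSpan R a b :=
  Submodule.subset_span ⟨(i, 0), by simp⟩

theorem one_mem_wordSpan (a b : E) : (1 : E) ∈ wordSpan R a b := by
  simpa [xWord] using xWord_mem_wordSpan a b 0

theorem snd_mem_wordSpan (a b : E) : b ∈ wordSpan R a b := by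
  simpa [xWord] using xWord_mem_wordSpan a b 1

theorem full_twist_mem_wordSpan (a b : E) : (a * b) ^ 3 ∈ wordSpan R a b := by
  simpa [xWord] using xWord_mem_wordSpan a b 4

theorem full_twist_snd_mem_wordSpan (a b : E) : (a * b) ^ 3 * b ∈ wordSpan R a b := by
  simpa [xWord] using xWord_mem_wordSpan a b 5

/-- Multiplying the cubic by the inverse lowers every degree by one, and the constant term becomes a
multiple of the inverse. -/
theorem inv_eq_of_cubic {e₁ e₂ e₃ e₃' : R} {s s' : E} (he : e₃' * e₃ = 1) (hs : s * s' = 1)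
    (h : s * (s * s) + e₂ • s = e₁ • (s * s) + e₃ • 1) :
    s' = e₃' • (s * s - e₁ • s + e₂ • 1) := by
  have h1 := congrArg (· * s') h
  simp only [add_mul, smul_mul_assoc, one_mul, mul_assoc, hs, mul_one] at h1
  have h2 : e₃ • s' = s * s - e₁ • s + e₂ • 1 := by
    rw [← sub_eq_zero] at h1 ⊢
    rw [← neg_eq_zero, ← h1]
    module
  rw [← h2, smul_smul, he, one_smul]

namespace CubicBraidPair

variable {e₁ e₂ e₃ e₃' : R} {a a' b b' : E} (h : CubicBraidPair e₁ e₂ e₃ e₃' a a' b b')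
include h

theorem braid_assoc (t : E) : b * (a * (b * t)) = a * (b * (a * t)) := by
  simpa only [mul_assoc] using congrArg (· * t) h.braid

theorem inv_fst_cancel (t : E) : a' * (a * t) = t := by
  rw [← mul_assoc, h.inv_mul_fst, one_mul]

theorem fst_inv_cancel (t : E) : a * (a' * t) = t := by
  rw [← mul_assoc, h.mul_inv_fst, one_mul]

theorem cube_fst : a * (a * a) = e₁ • (a * a) - e₂ • a + e₃ • 1 := by
  rw [sub_add_eq_add_sub, ← h.cubic_fst, add_sub_cancel_right]

theorem cube_snd : b * (b * b) = e₁ • (b * b) - e₂ • b + e₃ • 1 := by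
  rw [sub_add_eq_add_sub, ← h.cubic_snd, add_sub_cancel_right]

theorem cube_fst_mul (t : E) :
    a * (a * (a * t)) = e₁ • (a * (a * t)) - e₂ • (a * t) + e₃ • t := by
  simpa only [mul_assoc, add_mul, sub_mul, smul_mul_assoc, one_mul] using
    congrArg (· * t) h.cube_fst

theorem inv_fst_eq : a' = e₃' • (a * a - e₁ • a + e₂ • 1) :=
  inv_eq_of_cubic h.mul_inv_coeff h.mul_inv_fst h.cubic_fst

theorem inv_snd_eq : b' = e₃' • (b * b - e₁ • b + e₂ • 1) :=
  inv_eq_of_cubic h.mul_inv_coeff h.mul_inv_snd h.cubic_snd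

theorem sq_snd : b * b = e₁ • b - e₂ • 1 + e₃ • b' := by
  rw [h.inv_snd_eq, smul_smul, mul_comm, h.mul_inv_coeff]
  module

theorem full_twist : (a * b) ^ 3 = a * (b * (a * (a * (b * a)))) := by
  rw [pow_three]
  simp only [mul_assoc]
  rw [h.braid]

theorem full_twist_two : (a * b) ^ 3 = a * (a * (b * (a * (a * b)))) := by
  rw [pow_three]
  simp only [mul_assoc]
  rw [h.braid_assoc]

theorem full_twist_mul_fst : (a * b) ^ 3 * a = a * (a * b) ^ 3 := by
  conv_rhs => rw [h.full_twist]
  rw [h.full_twist_two]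
  simp only [mul_assoc]

theorem full_twist_mul_snd' : (a * b) ^ 3 * b = a * (b * (a * (a * (a * (b * a))))) := by
  rw [h.full_twist]
  simp only [mul_assoc]
  rw [h.braid]

/-- Both sides equal aba³ba. -/
theorem full_twist_mul_snd : (a * b) ^ 3 * b = b * (a * b) ^ 3 := by
  rw [h.full_twist_mul_snd', h.full_twist, h.braid_assoc]

theorem full_twist_mul_inv_snd : (a * b) ^ 3 * b' = a * (a * (b * (a * a))) := by
  rw [h.full_twist_two]
  simp only [mul_assoc, h.mul_inv_snd, mul_one]

theorem full_twist_fst_mul (t : E) : (a * b) ^ 3 * (a * t) = a * ((a * b) ^ 3 * t) := by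
  rw [← mul_assoc, h.full_twist_mul_fst, mul_assoc]

theorem full_twist_inv_fst_mul (t : E) :
    (a * b) ^ 3 * (a' * t) = a' * ((a * b) ^ 3 * t) := by
  conv_rhs => rw [← h.fst_inv_cancel t, h.full_twist_fst_mul, h.inv_fst_cancel]

theorem full_twist_snd_mul (t : E) :
    (a * b) ^ 3 * (b * t) = a * (b * (a * (a * (a * (b * (a * t)))))) := by
  simpa only [mul_assoc] using congrArg (· * t) h.full_twist_mul_snd'

theorem full_twist_sq : (a * b) ^ 3 * (a * b) ^ 3 =
    a * (a * (a * (b * (a * (a * (a * (b * (a * (a * (a * b)))))))))) := by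
  conv_lhs => enter [2]; rw [h.full_twist_two]
  rw [h.full_twist_fst_mul, h.full_twist_fst_mul, h.full_twist_snd_mul]

theorem snd_fst_fst_snd : b * (a * (a * b)) = a' * ((a * b) ^ 3 * a') := by
  rw [h.full_twist]
  simp only [mul_assoc, h.mul_inv_fst, mul_one, h.inv_fst_cancel]

theorem fst_mul_mem {s : E} (hs : s ∈ wordSpan R a b) : a * s ∈ wordSpan R a b := by
  induction hs using Submodule.span_induction with
  | mem t ht =>
    obtain ⟨⟨i, m⟩, rfl⟩ := ht
    have hm : ∀ k : Fin 3, a ^ (k : ℕ) * xWord a b i ∈ wordSpan R a b := fun k =>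
      Submodule.subset_span ⟨(i, k), rfl⟩
    have h0 := hm 0
    have h1 := hm 1
    have h2 := hm 2
    simp only [Fin.val_zero, Fin.val_one, Fin.val_two, pow_zero, pow_one, pow_two, one_mul,
      mul_assoc] at h0 h1 h2
    fin_cases m
    · simpa using h1
    · simpa using h2
    · simp only [pow_two, mul_assoc, h.cube_fst_mul]
      exact add_mem (sub_mem (Submodule.smul_mem _ _ h2) (Submodule.smul_mem _ _ h1))
        (Submodule.smul_mem _ _ h0)
  | zero => simp
  | add s t _ _ hs ht => rw [mul_add]; exact add_mem hs ht
  | smul c s _ hs => rw [mul_smul_comm]; exact Submodule.smul_mem _ _ hs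

theorem inv_fst_mul_mem {s : E} (hs : s ∈ wordSpan R a b) : a' * s ∈ wordSpan R a b := by
  rw [h.inv_fst_eq]
  simp only [smul_mul_assoc, add_mul, sub_mul, one_mul, mul_assoc]
  exact Submodule.smul_mem _ _ (add_mem (sub_mem (h.fst_mul_mem (h.fst_mul_mem hs))
    (Submodule.smul_mem _ _ (h.fst_mul_mem hs))) (Submodule.smul_mem _ _ hs))

theorem pow_fst_mul_mem (n : ℕ) {s : E} (hs : s ∈ wordSpan R a b) :
    a ^ n * s ∈ wordSpan R a b := by
  induction n with
  | zero => simpa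
  | succ n ih => rw [pow_succ', mul_assoc]; exact h.fst_mul_mem ih

/-- The span is already stable under left multiplication by a, so only the eight products with the
xᵢ need checking. -/
theorem mul_mem_of_xWord_mul_mem {t : E} (ht : ∀ i, xWord a b i * t ∈ wordSpan R a b) {s : E}
    (hs : s ∈ wordSpan R a b) : s * t ∈ wordSpan R a b := by
  induction hs using Submodule.span_induction with
  | mem s hs =>
    obtain ⟨⟨i, m⟩, rfl⟩ := hs
    rw [mul_assoc]
    exact h.pow_fst_mul_mem _ (ht i)
  | zero => simp
  | add s t _ _ hs ht => rw [add_mul]; exact add_mem hs ht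
  | smul c s _ hs => rw [smul_mul_assoc]; exact Submodule.smul_mem _ _ hs

/-- By the braid relation ba = a⁻¹x₃; likewise ba² = a⁻¹x₄ below. -/
theorem snd_fst_mem : b * a ∈ wordSpan R a b := by
  simpa [xWord, mul_assoc, h.braid, h.inv_fst_cancel] using
    h.inv_fst_mul_mem (xWord_mem_wordSpan a b 2)

theorem snd_fst_fst_mem : b * (a * a) ∈ wordSpan R a b := by
  simpa [xWord, mul_assoc, h.braid_assoc, h.inv_fst_cancel] using
    h.inv_fst_mul_mem (xWord_mem_wordSpan a b 3)

theorem full_twist_snd_fst_mem : (a * b) ^ 3 * (b * a) ∈ wordSpan R a b := by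
  simpa [xWord, mul_assoc, h.braid, h.full_twist_fst_mul, h.inv_fst_cancel] using
    h.inv_fst_mul_mem (xWord_mem_wordSpan a b 6)

theorem full_twist_snd_fst_fst_mem : (a * b) ^ 3 * (b * (a * a)) ∈ wordSpan R a b := by
  simpa [xWord, mul_assoc, h.braid_assoc, h.full_twist_fst_mul, h.inv_fst_cancel] using
    h.inv_fst_mul_mem (xWord_mem_wordSpan a b 7)

theorem mul_fst_mem {s : E} (hs : s ∈ wordSpan R a b) : s * a ∈ wordSpan R a b := by
  have hb : b * (a * (a * a)) ∈ wordSpan R a b := by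
    simp only [h.cube_fst, mul_add, mul_sub, mul_smul_comm, mul_one]
    exact add_mem (sub_mem (Submodule.smul_mem _ _ h.snd_fst_fst_mem)
      (Submodule.smul_mem _ _ h.snd_fst_mem)) (Submodule.smul_mem _ _ (snd_mem_wordSpan a b))
  have hzb : (a * b) ^ 3 * (b * (a * (a * a))) ∈ wordSpan R a b := by
    simp only [h.cube_fst, mul_add, mul_sub, mul_smul_comm, mul_one]
    exact add_mem (sub_mem (Submodule.smul_mem _ _ h.full_twist_snd_fst_fst_mem)
      (Submodule.smul_mem _ _ h.full_twist_snd_fst_mem))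
      (Submodule.smul_mem _ _ (full_twist_snd_mem_wordSpan a b))
  refine h.mul_mem_of_xWord_mul_mem (fun i => ?_) hs
  fin_cases i
  · simpa [xWord] using h.fst_mul_mem (one_mem_wordSpan a b)
  · simpa [xWord] using h.snd_fst_mem
  · simpa [xWord, mul_assoc, h.braid_assoc] using h.fst_mul_mem h.snd_fst_fst_mem
  · simpa [xWord, mul_assoc, h.braid_assoc] using h.fst_mul_mem hb
  · simpa [xWord, h.full_twist_mul_fst] using h.fst_mul_mem (full_twist_mem_wordSpan a b)
  · simpa [xWord, mul_assoc] using h.full_twist_snd_fst_mem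
  · simpa [xWord, mul_assoc, h.braid_assoc, h.full_twist_fst_mul] using
      h.fst_mul_mem h.full_twist_snd_fst_fst_mem
  · simpa [xWord, mul_assoc, h.braid_assoc, h.full_twist_fst_mul] using h.fst_mul_mem hzb

theorem mul_inv_fst_mem {s : E} (hs : s ∈ wordSpan R a b) : s * a' ∈ wordSpan R a b := by
  rw [h.inv_fst_eq]
  simp only [mul_smul_comm, mul_add, mul_sub, mul_one, ← mul_assoc]
  exact Submodule.smul_mem _ _ (add_mem (sub_mem (h.mul_fst_mem (h.mul_fst_mem hs))
    (Submodule.smul_mem _ _ (h.mul_fst_mem hs))) (Submodule.smul_mem _ _ hs))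

theorem snd_fst_fst_snd_mem : b * (a * (a * b)) ∈ wordSpan R a b := by
  rw [h.snd_fst_fst_snd, ← mul_assoc]
  exact h.mul_inv_fst_mem (h.inv_fst_mul_mem (full_twist_mem_wordSpan a b))

theorem snd_fst_snd_mem : b * (a * b) ∈ wordSpan R a b := by
  rw [h.braid]
  exact h.fst_mul_mem h.snd_fst_mem

theorem snd_cube_fst_snd_mem : b * (a * (a * (a * b))) ∈ wordSpan R a b := by
  have h1 : b * (a * (a * (a * b))) = a' * ((a * b) ^ 3 * b) * a' := by
    rw [h.full_twist_mul_snd']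
    simp only [mul_assoc, h.mul_inv_fst, mul_one, h.inv_fst_cancel]
  rw [h1]
  exact h.mul_inv_fst_mem (h.inv_fst_mul_mem (full_twist_snd_mem_wordSpan a b))

/-- Expanding a³ in ba³b by the cubic gives e₁ba²b - e₂bab + e₃b². Every other term is known to lie
in the span, and e₃ is invertible. -/
theorem snd_snd_mem : b * b ∈ wordSpan R a b := by
  have h1 := h.snd_cube_fst_snd_mem
  rw [h.cube_fst_mul, mul_add, mul_sub, mul_smul_comm, mul_smul_comm, mul_smul_comm] at h1
  have h2 : e₃ • (b * b) ∈ wordSpan R a b := by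
    have h3 := sub_mem h1 (sub_mem (Submodule.smul_mem _ e₁ h.snd_fst_fst_snd_mem)
      (Submodule.smul_mem _ e₂ h.snd_fst_snd_mem))
    rwa [add_sub_cancel_left] at h3
  simpa only [smul_smul, h.mul_inv_coeff, one_smul] using Submodule.smul_mem _ e₃' h2

/-- Trade b² for b⁻¹ by the cubic; then zb⁻¹ = a²ba² has no factor z left. -/
theorem full_twist_snd_snd_mem : (a * b) ^ 3 * (b * b) ∈ wordSpan R a b := by
  rw [h.sq_snd]
  simp only [mul_add, mul_sub, mul_smul_comm, mul_one, h.full_twist_mul_inv_snd]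
  exact add_mem (sub_mem (Submodule.smul_mem _ _ (full_twist_snd_mem_wordSpan a b))
    (Submodule.smul_mem _ _ (full_twist_mem_wordSpan a b)))
    (Submodule.smul_mem _ _ (h.fst_mul_mem (h.fst_mul_mem h.snd_fst_fst_mem)))

theorem cube_snd_mem : b * (b * b) ∈ wordSpan R a b := by
  rw [h.cube_snd]
  exact add_mem (sub_mem (Submodule.smul_mem _ _ h.snd_snd_mem)
    (Submodule.smul_mem _ _ (snd_mem_wordSpan a b))) (Submodule.smul_mem _ _ (one_mem_wordSpan a b))

/-- A prefix ba²b becomes a⁻¹za⁻¹, which reduces words with three letters b to z times words with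
one. -/
theorem snd_fst_fst_snd_mul_mem {s : E} (hs : (a * b) ^ 3 * (a' * s) ∈ wordSpan R a b) :
    b * (a * (a * (b * s))) ∈ wordSpan R a b := by
  have h1 : b * (a * (a * (b * s))) = a' * ((a * b) ^ 3 * (a' * s)) := by
    simpa only [mul_assoc] using congrArg (· * s) h.snd_fst_fst_snd
  rw [h1]
  exact h.inv_fst_mul_mem hs

theorem full_twist_fst_mul_mem {s : E} (hs : (a * b) ^ 3 * s ∈ wordSpan R a b) :
    (a * b) ^ 3 * (a * s) ∈ wordSpan R a b := by
  rw [h.full_twist_fst_mul]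
  exact h.fst_mul_mem hs

theorem full_twist_inv_fst_mul_mem {s : E} (hs : (a * b) ^ 3 * s ∈ wordSpan R a b) :
    (a * b) ^ 3 * (a' * s) ∈ wordSpan R a b := by
  rw [h.full_twist_inv_fst_mul]
  exact h.inv_fst_mul_mem hs

theorem snd_fst_fst_snd_snd_mem : b * (a * (a * (b * b))) ∈ wordSpan R a b :=
  h.snd_fst_fst_snd_mul_mem (h.full_twist_inv_fst_mul_mem (full_twist_snd_mem_wordSpan a b))

theorem snd_fst_fst_snd_fst_snd_mem : b * (a * (a * (b * (a * b)))) ∈ wordSpan R a b :=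
  h.snd_fst_fst_snd_mul_mem
    (h.full_twist_inv_fst_mul_mem (h.full_twist_fst_mul_mem (full_twist_snd_mem_wordSpan a b)))

theorem snd_fst_fst_snd_fst_fst_snd_mem :
    b * (a * (a * (b * (a * (a * b))))) ∈ wordSpan R a b :=
  h.snd_fst_fst_snd_mul_mem (h.full_twist_inv_fst_mul_mem
    (h.full_twist_fst_mul_mem (h.full_twist_fst_mul_mem (full_twist_snd_mem_wordSpan a b))))

theorem snd_fst_snd_snd_mem : b * (a * (b * b)) ∈ wordSpan R a b := by
  rw [h.braid_assoc]
  exact h.fst_mul_mem h.snd_fst_snd_mem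

theorem snd_fst_snd_fst_snd_mem : b * (a * (b * (a * b))) ∈ wordSpan R a b := by
  rw [h.braid_assoc]
  exact h.fst_mul_mem h.snd_fst_fst_snd_mem

theorem snd_fst_snd_fst_fst_snd_mem : b * (a * (b * (a * (a * b)))) ∈ wordSpan R a b := by
  rw [h.braid_assoc]
  exact h.fst_mul_mem h.snd_cube_fst_snd_mem

theorem snd_snd_fst_snd_mem : b * (b * (a * b)) ∈ wordSpan R a b := by
  rw [h.braid, h.braid_assoc]
  exact h.fst_mul_mem h.snd_fst_fst_mem

/-- Centrality of z turns b·a⁻¹za⁻¹ into zba⁻². -/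
theorem snd_snd_fst_fst_snd_mem : b * (b * (a * (a * b))) ∈ wordSpan R a b := by
  have h1 : b * (b * (a * (a * b))) = (a * b) ^ 3 * b * a' * a' := by
    rw [h.snd_fst_fst_snd, ← h.full_twist_inv_fst_mul, ← mul_assoc, ← h.full_twist_mul_snd]
    simp only [mul_assoc]
  rw [h1]
  exact h.mul_inv_fst_mem (h.mul_inv_fst_mem (full_twist_snd_mem_wordSpan a b))

theorem full_twist_sq_mem : (a * b) ^ 3 * (a * b) ^ 3 ∈ wordSpan R a b := by
  rw [h.full_twist_sq]
  refine h.fst_mul_mem (h.fst_mul_mem (h.fst_mul_mem ?_))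
  simp only [h.cube_fst_mul, mul_add, mul_sub, mul_smul_comm]
  -- After dropping the leading a³, expanding both inner cubes leaves the nine words baⁱbaʲb with 0
  -- ≤ i, j ≤ 2.
  have h1 := h.cube_snd_mem
  have h2 := h.snd_fst_fst_snd_snd_mem
  have h3 := h.snd_fst_fst_snd_fst_snd_mem
  have h4 := h.snd_fst_fst_snd_fst_fst_snd_mem
  have h5 := h.snd_fst_snd_snd_mem
  have h6 := h.snd_fst_snd_fst_snd_mem
  have h7 := h.snd_fst_snd_fst_fst_snd_mem
  have h8 := h.snd_snd_fst_snd_mem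
  have h9 := h.snd_snd_fst_fst_snd_mem
  apply_rules [add_mem, sub_mem, Submodule.smul_mem]

theorem mul_snd_mem {s : E} (hs : s ∈ wordSpan R a b) : s * b ∈ wordSpan R a b := by
  refine h.mul_mem_of_xWord_mul_mem (fun i => ?_) hs
  fin_cases i
  · simpa [xWord] using snd_mem_wordSpan a b
  · simpa [xWord] using h.snd_snd_mem
  · simpa [xWord, mul_assoc, h.braid_assoc] using h.snd_fst_snd_snd_mem
  · simpa [xWord, mul_assoc, h.braid_assoc] using h.snd_fst_snd_fst_snd_mem
  · simpa [xWord] using full_twist_snd_mem_wordSpan a b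
  · simpa [xWord, mul_assoc] using h.full_twist_snd_snd_mem
  · simpa [xWord, mul_assoc, h.braid, h.full_twist_fst_mul] using
      h.fst_mul_mem (h.fst_mul_mem h.full_twist_snd_fst_mem)
  -- Here x₈b = z·a·ba²b = z²a⁻¹, the only case in which z² occurs.
  · simpa [xWord, mul_assoc, h.braid_assoc, h.snd_fst_fst_snd, h.full_twist_fst_mul,
      h.full_twist_inv_fst_mul, h.fst_inv_cancel] using h.mul_inv_fst_mem h.full_twist_sq_mem

theorem mul_inv_snd_mem {s : E} (hs : s ∈ wordSpan R a b) : s * b' ∈ wordSpan R a b := by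
  rw [h.inv_snd_eq]
  simp only [mul_smul_comm, mul_add, mul_sub, mul_one, ← mul_assoc]
  exact Submodule.smul_mem _ _ (add_mem (sub_mem (h.mul_snd_mem (h.mul_snd_mem hs))
    (Submodule.smul_mem _ _ (h.mul_snd_mem hs))) (Submodule.smul_mem _ _ hs))

end CubicBraidPair

end Spanning

/-! ### From R-independence and spanning to the two bases -/

section Bases

variable {R E : Type*} [CommRing R] [Ring E] [Algebra R E]

theorem exists_basis_words {a b : E}
    (hli : LinearIndependent R fun p : Fin 8 × Fin 3 => a ^ (p.2 : ℕ) * xWord a b p.1)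
    (hspan : wordSpan R a b = ⊤) :
    ∃ B : Module.Basis (Fin 8 × Fin 3) R E,
      ∀ (i : Fin 8) (m : Fin 3), B (i, m) = a ^ (m : ℕ) * xWord a b i :=
  ⟨.mk hli hspan.ge, fun _ _ => Module.Basis.mk_apply _ _ _⟩

namespace CubicBraidPair

variable {e₁ e₂ e₃ e₃' : R} {a a' b b' : E} (h : CubicBraidPair e₁ e₂ e₃ e₃' a a' b b')
include h

/-- The cubic reduces every power of a to degree at most 2. Uniqueness of the coefficients is not
needed. -/
theorem exists_coeff_adjoin (t : Algebra.adjoin R {a}) :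
    ∃ c : Fin 3 → R, ∑ m, c m • a ^ (m : ℕ) = (t : E) := by
  rw [← Submodule.mem_span_range_iff_exists_fun]
  have hmem : ∀ m : Fin 3, a ^ (m : ℕ) ∈
      Submodule.span R (Set.range fun m : Fin 3 => a ^ (m : ℕ)) :=
    fun m => Submodule.subset_span ⟨m, rfl⟩
  have hpow : ∀ n : ℕ, a ^ n ∈
      Submodule.span R (Set.range fun m : Fin 3 => a ^ (m : ℕ)) := fun n => by
    induction n using Nat.strong_induction_on with
    | _ n ih =>
      match n, ih with
      | 0, _ => exact hmem 0
      | 1, _ => exact hmem 1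
      | 2, _ => exact hmem 2
      | n + 3, ih =>
        have h3 : a ^ (n + 3) = a * (a * (a * a ^ n)) := by
          simp only [← pow_succ']
        rw [h3, h.cube_fst_mul]
        simp only [← pow_succ']
        exact add_mem (sub_mem (Submodule.smul_mem _ _ (ih _ (by omega)))
          (Submodule.smul_mem _ _ (ih _ (by omega)))) (Submodule.smul_mem _ _ (ih _ (by omega)))
  obtain ⟨t, ht⟩ := t
  rw [Algebra.adjoin_singleton_eq_range_aeval] at ht
  obtain ⟨P, rfl⟩ := ht
  change Polynomial.aeval a P ∈ _
  rw [Polynomial.aeval_eq_sum_range]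
  exact sum_mem fun n _ => Submodule.smul_mem _ _ (hpow n)

/-- Expanding each H'-coefficient in 1, a, a² turns a relation over H' into one over R among the 24
words. -/
theorem linearIndependent_xWord
    (hli : LinearIndependent R fun p : Fin 8 × Fin 3 => a ^ (p.2 : ℕ) * xWord a b p.1) :
    LinearIndependent (Algebra.adjoin R {a}) (xWord a b) := by
  rw [Fintype.linearIndependent_iff]
  intro g hg i
  choose c hc using fun i => h.exists_coeff_adjoin (g i)
  have hzero := Fintype.linearIndependent_iff.1 hli (fun p => c p.1 p.2) (by
    rw [Fintype.sum_prod_type, ← hg]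
    refine Finset.sum_congr rfl fun i _ => ?_
    rw [Subalgebra.smul_def, smul_eq_mul, ← hc, Finset.sum_mul]
    exact Finset.sum_congr rfl fun m _ => (smul_mul_assoc _ _ _).symm)
  rw [Subtype.ext_iff, ← hc]
  exact Finset.sum_eq_zero fun m _ => by rw [hzero (i, m), zero_smul]

theorem exists_basis_adjoin
    (hli : LinearIndependent R fun p : Fin 8 × Fin 3 => a ^ (p.2 : ℕ) * xWord a b p.1)
    (hspan : wordSpan R a b = ⊤) :
    ∃ B : Module.Basis (Fin 8) (Algebra.adjoin R {a}) E, ∀ i : Fin 8, B i = xWord a b i := by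
  have hle : wordSpan R a b ≤
      (Submodule.span (Algebra.adjoin R {a}) (Set.range (xWord a b))).restrictScalars R := by
    rw [wordSpan, Submodule.span_le]
    rintro _ ⟨⟨i, m⟩, rfl⟩
    exact Submodule.smul_mem _
      ((⟨a, Algebra.self_mem_adjoin_singleton R a⟩ : Algebra.adjoin R {a}) ^ (m : ℕ))
      (Submodule.subset_span ⟨i, rfl⟩)
  rw [hspan] at hle
  exact ⟨.mk (h.linearIndependent_xWord hli) fun _ _ => hle trivial,
    fun _ => Module.Basis.mk_apply _ _ _⟩

end CubicBraidPair

end Bases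

/-! ### Consequences of a split cubic equation -/

section Cubic

variable {R E : Type*} [CommRing R] [Ring E] [Algebra R E]

/-- The factored cubic is kept as a term rather than set to zero, so the identity applies in R[B]
before passing to the quotient. -/
theorem cubic_expand (p q r : R) (s : E) :
    s * (s * s) + (p * q + p * r + q * r) • s =
      (s - algebraMap R E p) * (s - algebraMap R E q) * (s - algebraMap R E r) +
      ((p + q + r) • (s * s) + (p * q * r) • 1) := by
  simp only [Algebra.algebraMap_eq_smul_one, sub_mul, mul_sub, smul_mul_assoc, mul_smul_comm,
    one_mul, mul_one, smul_smul, smul_sub, mul_assoc]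
  module

/-- The constant term pqr is a unit, so the cubic exhibits an inverse as a polynomial in s. -/
theorem isUnit_of_cubic {p q r : R} {s : E} (hp : IsUnit p) (hq : IsUnit q) (hr : IsUnit r)
    (hs : (s - algebraMap R E p) * (s - algebraMap R E q) * (s - algebraMap R E r) = 0) :
    IsUnit s := by
  obtain ⟨v, hv⟩ := ((hp.mul hq).mul hr).exists_left_inv
  have h := cubic_expand p q r s
  rw [hs, zero_add, ← sub_eq_iff_eq_add'] at h
  have h1 : v • (s * (s * s) + (p * q + p * r + q * r) • s - (p + q + r) • (s * s)) = 1 := by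
    rw [h, smul_smul, hv, one_smul]
  refine ⟨⟨s, v • (s * s - (p + q + r) • s + (p * q + p * r + q * r) • 1), ?_, ?_⟩, rfl⟩ <;>
  · refine Eq.trans ?_ h1
    simp only [mul_smul_comm, smul_mul_assoc, mul_add, add_mul, mul_sub, sub_mul, mul_one, one_mul,
      mul_assoc]
    module

end Cubic

/-! ### The 24 words span the Hecke algebra -/

section HeckeSpan

/-- The inverses of the indeterminates. -/
noncomputable def uInv (j : Fin 3) : G4LaurentRing :=
  AddMonoidAlgebra.single (Finsupp.single j (-1)) 1

theorem u_mul_uInv (j : Fin 3) : u j * uInv j = 1 := by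
  rw [u, uInv, AddMonoidAlgebra.single_mul_single, ← Finsupp.single_add]
  simp [AddMonoidAlgebra.one_def]

/-- The inverses of the standard generators of the Hecke algebra. -/
noncomputable def σInv (i : Fin 2) : HeckeAlgebra :=
  RingQuot.mkAlgHom G4LaurentRing HeckeRel
    (MonoidAlgebra.of G4LaurentRing BraidGroup (PresentedGroup.of i)⁻¹)

theorem σ_mul_σInv (i : Fin 2) : σ i * σInv i = 1 := by
  rw [σ, σInv, braidGen, ← map_mul, ← map_mul, mul_inv_cancel, map_one, map_one]

theorem σInv_mul_σ (i : Fin 2) : σInv i * σ i = 1 := by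
  rw [σ, σInv, braidGen, ← map_mul, ← map_mul, inv_mul_cancel, map_one, map_one]

theorem σ_braid : σ 1 * (σ 0 * σ 1) = σ 0 * (σ 1 * σ 0) := by
  have h : (PresentedGroup.of 0 * PresentedGroup.of 1 * PresentedGroup.of 0 : BraidGroup) =
      PresentedGroup.of 1 * PresentedGroup.of 0 * PresentedGroup.of 1 := by
    rw [← mul_inv_eq_one]
    exact PresentedGroup.one_of_mem (rels := braidRels) rfl
  rw [mul_assoc, mul_assoc] at h
  simp only [σ, braidGen, ← map_mul, h]

theorem σ_cubic (i : Fin 2) :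
    σ i * (σ i * σ i) + (u 0 * u 1 + u 0 * u 2 + u 1 * u 2) • σ i =
      (u 0 + u 1 + u 2) • (σ i * σ i) + (u 0 * u 1 * u 2) • 1 := by
  have h := RingQuot.mkAlgHom_rel G4LaurentRing (HeckeRel.cubic i)
  simp only [map_zero] at h
  have key := congrArg (RingQuot.mkAlgHom G4LaurentRing HeckeRel)
    (cubic_expand (u 0) (u 1) (u 2) (braidGen i))
  rw [map_add _ (_ * _ * _), h, zero_add] at key
  simp only [map_add, map_mul, map_smul, map_one] at key
  exact key

theorem σ_cubicBraidPair : CubicBraidPair (u 0 + u 1 + u 2)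
    (u 0 * u 1 + u 0 * u 2 + u 1 * u 2) (u 0 * u 1 * u 2) (uInv 0 * uInv 1 * uInv 2)
    (σ 0) (σInv 0) (σ 1) (σInv 1) where
  mul_inv_coeff := by
    calc uInv 0 * uInv 1 * uInv 2 * (u 0 * u 1 * u 2) =
        (u 0 * uInv 0) * (u 1 * uInv 1) * (u 2 * uInv 2) := by ring
      _ = 1 := by simp only [u_mul_uInv, mul_one]
  inv_mul_fst := σInv_mul_σ 0
  mul_inv_fst := σ_mul_σInv 0
  mul_inv_snd := σ_mul_σInv 1
  braid := σ_braid
  cubic_fst := σ_cubic 0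
  cubic_snd := σ_cubic 1

/-- A property of elements of the Hecke algebra that is linear, multiplicative and true of the
generators and their inverses is true of all elements. -/
theorem HeckeAlgebra.induction {p : HeckeAlgebra → Prop} (t : HeckeAlgebra) (hone : p 1)
    (hσ : ∀ i, p (σ i)) (hσInv : ∀ i, p (σInv i)) (hmul : ∀ s t, p s → p t → p (s * t))
    (hadd : ∀ s t, p s → p t → p (s + t)) (hsmul : ∀ (c : G4LaurentRing) t, p t → p (c • t)) :
    p t := by
  obtain ⟨t, rfl⟩ := RingQuot.mkAlgHom_surjective G4LaurentRing HeckeRel t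
  induction t using MonoidAlgebra.induction_on with
  | of g =>
    induction g using PresentedGroup.induction_on with
    | _ w =>
      induction w using FreeGroup.induction_on with
      | C1 => rw [map_one, map_one, map_one]; exact hone
      | of i => exact hσ i
      | inv_of i _ => rw [map_inv]; exact hσInv i
      | mul v w hv hw => simp only [map_mul] at hv hw ⊢; exact hmul _ _ hv hw
  | add s t hs ht => rw [map_add]; exact hadd _ _ hs ht
  | smul c t ht => rw [map_smul]; exact hsmul _ _ ht

theorem wordSpan_eq_top : wordSpan G4LaurentRing (σ 0) (σ 1) = ⊤ := by
  rw [Submodule.eq_top_iff']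
  intro t
  -- Quantifying over the whole span, not just s = 1, lets the induction pass through products.
  suffices h : ∀ s : wordSpan G4LaurentRing (σ 0) (σ 1),
      (s : HeckeAlgebra) * t ∈ wordSpan G4LaurentRing (σ 0) (σ 1) by
    simpa only [one_mul] using h ⟨1, one_mem_wordSpan _ _⟩
  induction t using HeckeAlgebra.induction with
  | hone => exact fun s => by rw [mul_one]; exact s.2
  | hσ i =>
    fin_cases i
    · exact fun s => σ_cubicBraidPair.mul_fst_mem s.2
    · exact fun s => σ_cubicBraidPair.mul_snd_mem s.2
  | hσInv i =>
    fin_cases i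
    · exact fun s => σ_cubicBraidPair.mul_inv_fst_mem s.2
    · exact fun s => σ_cubicBraidPair.mul_inv_snd_mem s.2
  | hmul t v ht hv => exact fun s => by rw [← mul_assoc]; exact hv ⟨_, ht s⟩
  | hadd t v ht hv => exact fun s => by rw [mul_add]; exact add_mem (ht s) (hv s)
  | hsmul c t ht => exact fun s => by rw [mul_smul_comm]; exact Submodule.smul_mem _ _ (ht s)

end HeckeSpan

/-! ### Linear independence via representations and specialisation -/

section HeckeRepresentation

/-- The image of the `i`-th generator under the sum of the irreducible representations. -/
noncomputable def rep (i : Fin 2) : MatrixProduct G4LaurentRing :=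
  ![repFst (u 0) (u 1) (u 2), repSnd (u 0) (u 1) (u 2)] i

theorem rep_cubic (i : Fin 2) :
    (rep i - algebraMap _ _ (u 0)) * (rep i - algebraMap _ _ (u 1)) *
      (rep i - algebraMap _ _ (u 2)) = 0 := by
  fin_cases i
  · exact cubic_repFst _ _ _
  · exact cubic_repSnd _ _ _

theorem isUnit_u (j : Fin 3) : IsUnit (u j) := IsUnit.of_mul_eq_one _ (u_mul_uInv j)

theorem isUnit_rep (i : Fin 2) : IsUnit (rep i) :=
  isUnit_of_cubic (isUnit_u 0) (isUnit_u 1) (isUnit_u 2) (rep_cubic i)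

/-- The sum of the irreducible representations of the Hecke algebra. -/
theorem exists_hom_rep : ∃ f : HeckeAlgebra →ₐ[G4LaurentRing] MatrixProduct G4LaurentRing,
    ∀ i, f (σ i) = rep i := by
  -- The images must be units for the map to be defined on the braid group.
  choose v hv using isUnit_rep
  have hrel : ∀ r ∈ braidRels, FreeGroup.lift v r = 1 := by
    rintro _ rfl
    simp only [map_mul, map_inv, FreeGroup.lift_apply_of]
    rw [mul_inv_eq_one]
    ext1
    simp only [Units.val_mul, hv]
    exact repFst_braid _ _ _
  let g := MonoidAlgebra.lift G4LaurentRing (MatrixProduct G4LaurentRing) BraidGroup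
    ((Units.coeHom _).comp (PresentedGroup.toGroup hrel))
  have hg : ∀ i, g (braidGen i) = rep i := fun i => by
    simp [g, braidGen, hv]
  refine ⟨RingQuot.liftAlgHom G4LaurentRing ⟨g, ?_⟩, fun i => ?_⟩
  · rintro _ _ ⟨i⟩
    rw [map_mul, map_mul, map_sub, map_sub, map_sub, hg, AlgHom.commutes, AlgHom.commutes,
      AlgHom.commutes, rep_cubic, map_zero]
  · rw [σ, RingQuot.liftAlgHom_mkAlgHom_apply, hg]

/-- The specialisation of the Laurent polynomial ring at `1, 2, 4 ∈ 𝔽₇`. -/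
theorem exists_specialisation : ∃ f : G4LaurentRing →+* ZMod 7, f (u 0) = 1 ∧ f (u 1) = 2 ∧
    f (u 2) = 4 := by
  -- 1, 2, 4 are the cube roots of unity in 𝔽₇, so the cubic specialises to s³ = 1, the relation of
  -- the group G₄, whose order 24 is prime to 7.
  let v : Fin 3 → (ZMod 7)ˣ := ![1, ⟨2, 4, by decide, by decide⟩, ⟨4, 2, by decide, by decide⟩]
  let g : Multiplicative (Fin 3 →₀ ℤ) →* ZMod 7 := (Units.coeHom _).comp
    (AddMonoidHom.toMultiplicativeLeft
      (Finsupp.liftAddHom fun j => zmultiplesHom (Additive (ZMod 7)ˣ) (Additive.ofMul (v j))))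
  have hg : ∀ j, AddMonoidAlgebra.lift ℤ (ZMod 7) (Fin 3 →₀ ℤ) g (u j) = v j := fun j => by
    simp [u, g]
  exact ⟨(AddMonoidAlgebra.lift ℤ (ZMod 7) (Fin 3 →₀ ℤ) g : G4LaurentRing →+* ZMod 7),
    hg 0, hg 1, hg 2⟩

theorem linearIndependent_words : LinearIndependent G4LaurentRing
    fun p : Fin 8 × Fin 3 => σ 0 ^ (p.2 : ℕ) * x p.1 := by
  obtain ⟨f, hf⟩ := exists_hom_rep
  obtain ⟨φ, h0, h1, h2⟩ := exists_specialisation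
  let e : Fin 8 × Fin 3 ≃ Fin 24 := finProdFinEquiv
  let M : Matrix (Fin 24) (Fin 24) G4LaurentRing := fun k =>
    coordinates (f (σ 0 ^ ((e.symm k).2 : ℕ) * x (e.symm k).1))
  have hM : φ.mapMatrix M = coordMatrix := by
    ext k j
    obtain ⟨⟨i, m⟩, rfl⟩ := e.surjective k
    rw [show e (i, m) = finProdFinEquiv (i, m) from rfl, ← coordinates_specialised, RingHom.mapMatrix_apply, Matrix.map_apply]
    simp only [M, e, Equiv.symm_apply_apply]
    rw [← coordinates_mapMatrixProduct, map_mul, map_pow, hf, map_mul, map_pow]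
    have hx : f (x i) = xWord (f (σ 0)) (f (σ 1)) i := map_xWord f _ _ _
    rw [hx, map_xWord, hf, hf]
    simp only [rep, Matrix.cons_val_zero, Matrix.cons_val_one, mapMatrixProduct_repFst,
      mapMatrixProduct_repSnd, h0, h1, h2]
  -- A vanishing determinant would still vanish over 𝔽₇, against the explicit inverse there.
  have hdet : M.det ≠ 0 := fun hzero => by
    have hd := congrArg Matrix.det coordMatrix_mul_inv
    rw [Matrix.det_mul, ← hM, ← RingHom.map_det, hzero, map_zero, zero_mul, Matrix.det_one] at hd
    exact absurd hd (by decide)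
  have hrows := (Matrix.linearIndependent_rows_of_det_ne_zero hdet).comp e e.injective
  refine LinearIndependent.of_comp (coordinates ∘ₗ f.toLinearMap) ?_
  have hcomp : (coordinates ∘ₗ f.toLinearMap) ∘
      (fun p : Fin 8 × Fin 3 => σ 0 ^ (p.2 : ℕ) * x p.1) = (fun k => M k) ∘ e := by
    ext1 p
    simp [M]
  rw [hcomp]
  exact hrows

end HeckeRepresentation

end G4

/-! ### The two freeness statements -/

theorem mainTheorem5 :
    (∃ B : Module.Basis (Fin 8) G4.parabolicSubalgebra G4.HeckeAlgebra,
      ∀ i : Fin 8, B i = G4.x i) ∧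
    (∃ B : Module.Basis (Fin 8 × Fin 3) G4LaurentRing G4.HeckeAlgebra,
      ∀ (i : Fin 8) (m : Fin 3), B (i, m) = G4.σ 0 ^ (m : ℕ) * G4.x i) := by
  have hx : G4.x = G4.xWord (G4.σ 0) (G4.σ 1) := rfl
  have hli := G4.linearIndependent_words
  rw [hx] at hli ⊢
  exact ⟨G4.σ_cubicBraidPair.exists_basis_adjoin hli G4.wordSpan_eq_top,
    G4.exists_basis_words (R := G4LaurentRing) (E := G4.HeckeAlgebra)
      (a := G4.σ 0) (b := G4.σ 1) hli G4.wordSpan_eq_top⟩
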